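/- Let $(C_m)_{m\ge 0}$ be independent random variables on a probability space, with $C_m$ uniformly distributed on $\{0,1,\dots,m\}$. The uniform random recursive tree is built as follows: start from the single node $0$ (the root); for $n\ge 1$, at the $n$th step the new node $n$ is added and joined by an edge to the node $C_{n-1}\in\{0,\dots,n-1\}$. Let $L_n(k)$ be the set of nodes at graph distance $k$ from the root in the tree after $n$ steps (whose nodes are $0,1,\dots,n$), let $\deg_n(i)$ be the degree of node $i$ in this tree, and let $$Z_{n,k}(t)=\frac{1}{|L_n(k)|}\,\bigl|\{i\le n:\ i\in L_n(k),\ \deg_n(i)>t\log n\}\bigr|$$ (with $Z_{n,k}(t)=0$ for the finitely many $n$, almost surely, with $L_n(k)=\emptyset$). Then for every integer $k\ge 1$ and every real $t$ with $0<t<1$, $$\lim_{n\to\infty} Z_{n,k}(t)=(1-t)^k\quad\text{almost surely.}$$ -/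

import Mathlib

open MeasureTheory ProbabilityTheory Filter Topology

namespace RecursiveTree

/-- The recursive tree after `n` steps, on the vertices `0, 1, …, n`, for given choices:
`c m` is the vertex (one of `0, …, m`) chosen at step `m + 1`, and the new vertex `m + 1`
is joined to it. -/
def tree (c : (m : ℕ) → Fin (m + 1)) (n : ℕ) : SimpleGraph (Fin (n + 1)) :=
  SimpleGraph.fromRel fun i j => ∃ m : ℕ, (j : ℕ) = m + 1 ∧ (i : ℕ) = (c m : ℕ)

/-- `L_n(k)`: the set of the vertices at graph distance `k` from the root `0`
in the tree after `n` steps. -/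
noncomputable def level (c : (m : ℕ) → Fin (m + 1)) (n k : ℕ) : Finset (Fin (n + 1)) :=
  Finset.univ.filter fun i => (tree c n).dist 0 i = k

open Classical in
/-- `deg_n(i)`: the degree of the vertex `i` in the tree after `n` steps. -/
noncomputable def deg (c : (m : ℕ) → Fin (m + 1)) (n : ℕ) (i : Fin (n + 1)) : ℕ :=
  (tree c n).degree i

/-- `Z_{n,k}(t)`: the proportion of the vertices of degree greater than `t log n` in level `k`
of the tree after `n` steps (with value `0` as long as level `k` is empty). -/
noncomputable def Z (c : (m : ℕ) → Fin (m + 1)) (n k : ℕ) (t : ℝ) : ℝ :=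
  (((level c n k).filter fun i => t * Real.log n < (deg c n i : ℝ)).card : ℝ) /
    ((level c n k).card : ℝ)

/-- The choices that generate the uniform recursive tree: the vertex chosen at step `m + 1` is
uniformly distributed on `0, …, m`, and the choices at different steps are independent. -/
structure IsUniformChoice {Ω : Type*} [MeasurableSpace Ω] (μ : Measure Ω)
    (C : (m : ℕ) → Ω → Fin (m + 1)) : Prop where
  measurable : ∀ m, Measurable (C m)
  uniform : ∀ (m : ℕ) (v : Fin (m + 1)), μ {ω | C m ω = v} = ((m : ENNReal) + 1)⁻¹
  indep : iIndepFun C μ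

end RecursiveTree

namespace RecursiveTree

/-! Up to the edge to its parent, the degree of `i` is a sum of independent indicators with mean
`hsum n - hsum i`, about `log (n / i)`. Hence degree above `t log n` should mean `i` below about `n
^ (1 - t)`, and the proportion should be the level size at time `n ^ (1 - t)` over that at time `n`.
Level `k` has size about `(log n) ^ k / k!` (`tendsto_width`), which gives `(1 - t) ^ k`.

Level sizes follow by induction on `k`: level `k + 1` is its compensator, a sum of `width k m / (m +
1)`, plus a martingale of small second moment (`integral_widthNoise_sq_le`). The degree heuristic
may fail only for few vertices: the squared deviations over level `k` total at most `hsum n ^ (k +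
1)` in mean (`integral_childrenNoise_le`), so by Chebyshev `o((log n) ^ k)` vertices deviate by
order `log n`.

Both bounds become almost sure along the times `2 ^ j ^ 2`, where they are summable; monotonicity
fills the gaps, since `hsum` at consecutive such times has ratio tending to 1. -/

/-- The depth of the vertex `i`, computed along the path of parents. -/
def depth (c : (m : ℕ) → Fin (m + 1)) : ℕ → ℕ
  | 0 => 0
  | m + 1 => depth c (c m) + 1
decreasing_by exact (c m).isLt

/-- The number of children of the vertex `i` after `n` steps. -/
def children (c : (m : ℕ) → Fin (m + 1)) (n i : ℕ) : ℕ :=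
  ((Finset.range n).filter fun m => (c m : ℕ) = i).card

/-- The number of vertices of depth `k` after `n` steps. -/
def width (c : (m : ℕ) → Fin (m + 1)) (k n : ℕ) : ℕ :=
  ((Finset.range (n + 1)).filter fun i => depth c i = k).card

/-! ### Deterministic facts: distance, degree, adaptedness -/

section Tree

variable (c : (m : ℕ) → Fin (m + 1))

theorem depth_zero : depth c 0 = 0 := by rw [depth]

theorem depth_succ (m : ℕ) : depth c (m + 1) = depth c (c m) + 1 := by rw [depth]

theorem tree_adj {n : ℕ} {i j : Fin (n + 1)} :
    (tree c n).Adj i j ↔ (∃ m : ℕ, (j : ℕ) = m + 1 ∧ (i : ℕ) = (c m : ℕ)) ∨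
      ∃ m : ℕ, (i : ℕ) = m + 1 ∧ (j : ℕ) = (c m : ℕ) := by
  simp only [tree, SimpleGraph.fromRel_adj, and_iff_right_iff_imp]
  rintro (⟨m, h1, h2⟩ | ⟨m, h1, h2⟩) rfl <;> exact absurd (c m).isLt (by omega)

/-- Depth changes by one along an edge, so no walk from the root can beat the path of parents. -/
theorem depth_le_add_length {n : ℕ} {i j : Fin (n + 1)} (w : (tree c n).Walk i j) :
    depth c j ≤ depth c i + w.length := by
  induction w with
  | nil => simp
  | @cons u v x h w ih =>
    have : depth c v ≤ depth c u + 1 := by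
      rcases (tree_adj c).1 h with ⟨m, h1, h2⟩ | ⟨m, h1, h2⟩ <;>
      · have := depth_succ c m
        rw [h1, h2]
        omega
    rw [SimpleGraph.Walk.length_cons]
    omega

theorem exists_walk_length_eq_depth (n i : ℕ) (h : i < n + 1) :
    ∃ w : (tree c n).Walk 0 ⟨i, h⟩, w.length = depth c i := by
  induction i using Nat.strong_induction_on with
  | _ i ih =>
    cases i with
    | zero => exact ⟨SimpleGraph.Walk.nil, by simp [depth_zero]⟩
    | succ m =>
      have hlt := (c m).isLt
      obtain ⟨w, hw⟩ := ih (c m) hlt (by omega)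
      have hadj : (tree c n).Adj ⟨c m, by omega⟩ ⟨m + 1, h⟩ :=
        (tree_adj c).2 (Or.inl ⟨m, rfl, rfl⟩)
      exact ⟨w.concat hadj, by rw [SimpleGraph.Walk.length_concat, hw, depth_succ]⟩

theorem dist_eq_depth (n : ℕ) (i : Fin (n + 1)) : (tree c n).dist 0 i = depth c i := by
  obtain ⟨w, hw⟩ := exists_walk_length_eq_depth c n i i.isLt
  apply le_antisymm
  · rw [← hw]
    exact SimpleGraph.dist_le w
  · obtain ⟨p, hp⟩ := SimpleGraph.Reachable.exists_walk_length_eq_dist ⟨w⟩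
    have := depth_le_add_length c p
    rw [hp] at this
    simpa [depth_zero] using this

theorem children_le_deg (n : ℕ) (i : Fin (n + 1)) : children c n i ≤ deg c n i := by
  classical
  unfold children deg
  rw [← SimpleGraph.card_neighborFinset_eq_degree]
  refine Finset.card_le_card_of_injOn (fun m => Fin.ofNat (n + 1) (m + 1)) ?_ ?_
  · intro m hm
    simp only [Finset.coe_filter, Finset.mem_range, Set.mem_ofPred_eq] at hm
    simp only [Finset.mem_coe, SimpleGraph.mem_neighborFinset]
    exact (tree_adj c).2 (Or.inl ⟨m, by simp [Nat.mod_eq_of_lt, hm.1], hm.2.symm⟩)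
  · intro m hm m' hm' h
    simp only [Finset.coe_filter, Finset.mem_range, Set.mem_ofPred_eq] at hm hm'
    have := congrArg Fin.val h
    simp only [Fin.val_ofNat] at this
    rw [Nat.mod_eq_of_lt (by omega), Nat.mod_eq_of_lt (by omega)] at this
    omega

theorem deg_le_children_add_one (n : ℕ) (i : Fin (n + 1)) :
    deg c n i ≤ children c n i + 1 := by
  classical
  unfold children deg
  rw [← SimpleGraph.card_neighborFinset_eq_degree,
    ← Finset.card_map Fin.valEmbedding (s := (tree c n).neighborFinset i)]
  -- Besides its children, `i` has only its parent `c (i - 1)` as neighbour. At the root the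
  -- truncated subtraction inserts a spurious element, harmless for an upper bound.
  refine (Finset.card_le_card (t := insert (c (i - 1) : ℕ)
    (((Finset.range n).filter fun m => (c m : ℕ) = i).image Nat.succ)) ?_).trans
    ((Finset.card_insert_le _ _).trans (Nat.succ_le_succ Finset.card_image_le))
  intro j hj
  obtain ⟨j, hj', rfl⟩ := Finset.mem_map.1 hj
  rw [SimpleGraph.mem_neighborFinset, tree_adj] at hj'
  have hlt := j.isLt
  rcases hj' with ⟨m, h1, h2⟩ | ⟨m, h1, h2⟩
  · refine Finset.mem_insert_of_mem (Finset.mem_image.2 ⟨m, ?_, by simp [h1]⟩)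
    rw [Finset.mem_filter, Finset.mem_range]
    exact ⟨by omega, h2.symm⟩
  · refine Finset.mem_insert.2 (Or.inl ?_)
    have : (i : ℕ) - 1 = m := by omega
    rw [this]
    exact h2

theorem card_filter_level (n k : ℕ) (p : ℕ → Prop) [DecidablePred p] :
    ((level c n k).filter fun i : Fin (n + 1) => p i).card =
      ((Finset.range (n + 1)).filter fun i => depth c i = k ∧ p i).card := by
  unfold level
  simp_rw [dist_eq_depth, Finset.filter_filter]
  rw [← Finset.card_map Fin.valEmbedding]
  congr 1
  ext x
  simp only [Finset.mem_map, Finset.mem_filter, Finset.mem_univ, true_and, Fin.valEmbedding_apply,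
    Finset.mem_range]
  exact ⟨fun ⟨a, h, e⟩ => e ▸ ⟨a.isLt, h⟩, fun ⟨h, e⟩ => ⟨⟨x, h⟩, e, rfl⟩⟩

theorem card_level (n k : ℕ) : (level c n k).card = width c k n := by
  simpa [width] using card_filter_level c n k fun _ => True

theorem width_zero (n : ℕ) : width c 0 n = 1 := by
  unfold width
  rw [Finset.card_eq_one]
  refine ⟨0, ?_⟩
  ext i
  simp only [Finset.mem_filter, Finset.mem_range, Finset.mem_singleton]
  constructor
  · rintro ⟨-, h⟩
    cases i with
    | zero => rfl
    | succ m => simp [depth_succ] at h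
  · rintro rfl
    exact ⟨by omega, depth_zero c⟩

theorem width_succ_zero (k : ℕ) : width c (k + 1) 0 = 0 := by
  simp [width, depth_zero, Finset.filter_singleton]

theorem width_succ_succ (k n : ℕ) :
    width c (k + 1) (n + 1) = width c (k + 1) n + if depth c (c n) = k then 1 else 0 := by
  unfold width
  rw [Finset.range_add_one (n := n + 1), Finset.filter_insert, depth_succ]
  by_cases h : depth c (c n) = k <;> simp [h]

theorem width_mono (k : ℕ) : Monotone (width c k) := fun _ _ h =>
  Finset.card_le_card (Finset.filter_subset_filter _ (Finset.range_mono (Nat.succ_le_succ h)))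

theorem children_mono (i : ℕ) : Monotone fun n => children c n i := fun _ _ h =>
  Finset.card_le_card (Finset.filter_subset_filter _ (Finset.range_mono h))

theorem children_self (i : ℕ) : children c i i = 0 := by
  unfold children
  rw [Finset.card_eq_zero, Finset.filter_eq_empty_iff]
  intro m hm
  have := (c m).isLt
  have := Finset.mem_range.1 hm
  omega

theorem children_succ (n i : ℕ) :
    children c (n + 1) i = children c n i + if (c n : ℕ) = i then 1 else 0 := by
  unfold children
  rw [Finset.range_add_one, Finset.filter_insert]
  by_cases h : (c n : ℕ) = i <;> simp [h]

theorem card_filter_depth_eq_width (k n : ℕ) :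
    ((Finset.univ : Finset (Fin (n + 1))).filter fun v : Fin (n + 1) => depth c v = k).card =
      width c k n := by
  rw [← card_level, level]
  simp_rw [dist_eq_depth]

theorem depth_congr {c c' : (m : ℕ) → Fin (m + 1)} (i : ℕ) (h : ∀ m < i, c m = c' m) :
    depth c i = depth c' i := by
  induction i using Nat.strong_induction_on with
  | _ i ih =>
    cases i with
    | zero => simp only [depth_zero]
    | succ m =>
      rw [depth_succ, depth_succ, ← h m m.lt_succ_self]
      have := (c m).isLt
      rw [ih (c m) this fun l hl => h l (by omega)]

theorem width_congr {c c' : (m : ℕ) → Fin (m + 1)} (k n : ℕ) (h : ∀ m < n, c m = c' m) :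
    width c k n = width c' k n := by
  unfold width
  congr 1
  refine Finset.filter_congr fun i hi => ?_
  have := Finset.mem_range.1 hi
  rw [depth_congr i fun m hm => h m (by omega)]

theorem children_congr {c c' : (m : ℕ) → Fin (m + 1)} (n i : ℕ) (h : ∀ m < n, c m = c' m) :
    children c n i = children c' n i := by
  unfold children
  congr 1
  refine Finset.filter_congr fun m hm => ?_
  rw [h m (Finset.mem_range.1 hm)]

end Tree

/-! ### Averaging the next choice given the past -/

section Expectation

variable {Ω : Type*} [MeasurableSpace Ω] {μ : Measure Ω}
  {C : (m : ℕ) → Ω → Fin (m + 1)}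

/-- The first `n` choices range over a finite set, so factoring through them makes every adapted
quantity measurable and bounded. -/
theorem exists_eq_comp_restrict {n : ℕ} {F : ((m : ℕ) → Fin (m + 1)) → ℝ}
    (hF : DependsOn F (Set.Iio n)) :
    ∃ G : ((i : Finset.range n) → Fin ((i : ℕ) + 1)) → ℝ, ∀ c, F c = G fun i => c i := by
  refine ⟨fun x => F fun m => if h : m ∈ Finset.range n then x ⟨m, h⟩ else 0, fun c => hF ?_⟩
  intro m hm
  simp [Set.mem_Iio.1 hm]

theorem measurable_of_dependsOn (hC : IsUniformChoice μ C) {n : ℕ}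
    {F : ((m : ℕ) → Fin (m + 1)) → ℝ} (hF : DependsOn F (Set.Iio n)) :
    Measurable fun ω => F fun m => C m ω := by
  obtain ⟨G, hG⟩ := exists_eq_comp_restrict hF
  simp_rw [hG]
  exact (measurable_of_countable G).comp (measurable_pi_lambda _ fun i => hC.measurable i)

theorem integrable_of_dependsOn [IsProbabilityMeasure μ] (hC : IsUniformChoice μ C) {n : ℕ}
    {F : ((m : ℕ) → Fin (m + 1)) → ℝ} (hF : DependsOn F (Set.Iio n)) :
    Integrable (fun ω => F fun m => C m ω) μ := by
  have hm := measurable_of_dependsOn hC hF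
  obtain ⟨G, hG⟩ := exists_eq_comp_restrict hF
  refine Integrable.of_bound hm.aestronglyMeasurable (∑ x, ‖G x‖) (ae_of_all _ fun ω => ?_)
  rw [hG]
  exact Finset.single_le_sum (f := fun x => ‖G x‖) (fun _ _ => norm_nonneg _) (Finset.mem_univ _)

/-- The choice at step `n + 1` is independent of the past. -/
theorem integral_mul_indicator_eq (hC : IsUniformChoice μ C) {n : ℕ}
    {F : ((m : ℕ) → Fin (m + 1)) → ℝ} (hF : DependsOn F (Set.Iio n)) (v : Fin (n + 1)) :
    ∫ ω, F (fun m => C m ω) * (if C n ω = v then 1 else 0) ∂μ =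
      (∫ ω, F (fun m => C m ω) ∂μ) * (1 / ((n : ℝ) + 1)) := by
  have hm := measurable_of_dependsOn hC hF
  obtain ⟨G, hG⟩ := exists_eq_comp_restrict hF
  have hind := hC.indep.indepFun_finset (Finset.range n) {n} (by simp) hC.measurable
  have hind' := hind.comp (measurable_of_countable G)
    (measurable_of_countable fun x : ((i : ({n} : Finset ℕ)) → Fin ((i : ℕ) + 1)) =>
      if x ⟨n, by simp⟩ = v then (1 : ℝ) else 0)
  have hS : MeasurableSet {ω | C n ω = v} := hC.measurable n (MeasurableSet.singleton v)
  have hI : ∫ ω, (if C n ω = v then (1 : ℝ) else 0) ∂μ = 1 / ((n : ℝ) + 1) := by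
    have := integral_indicator_one (μ := μ) hS
    rw [measureReal_def, hC.uniform] at this
    have hfun : (fun ω => if C n ω = v then (1 : ℝ) else 0) = {ω | C n ω = v}.indicator 1 := by
      ext ω
      simp [Set.indicator]
    rw [one_div, hfun, this, ENNReal.toReal_inv, ENNReal.toReal_add (by simp) (by simp)]
    simp
  have := hind'.integral_fun_mul_eq_mul_integral ?_ ?_
  · simp only [Function.comp_def] at this
    simp_rw [hG]
    rw [← hI, ← this]
  · simp_rw [hG] at hm
    exact hm.aestronglyMeasurable
  · simp only [Function.comp_def]
    exact (Measurable.ite hS measurable_const measurable_const).aestronglyMeasurable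

variable [IsProbabilityMeasure μ]

/-- Given the past, the next parent falls in a past-determined set `A` with probability `|A| / (n +
1)`; split over the possible values of the choice to use independence. -/
theorem integral_mul_indicator_mem (hC : IsUniformChoice μ C) {n : ℕ}
    {F : ((m : ℕ) → Fin (m + 1)) → ℝ} (hF : DependsOn F (Set.Iio n))
    {A : ((m : ℕ) → Fin (m + 1)) → Finset (Fin (n + 1))} (hA : DependsOn A (Set.Iio n)) :
    ∫ ω, F (fun m => C m ω) * (if C n ω ∈ A (fun m => C m ω) then 1 else 0) ∂μ =
      ∫ ω, F (fun m => C m ω) * ((A fun m => C m ω).card / ((n : ℝ) + 1)) ∂μ := by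
  have hFA (v : Fin (n + 1)) :
      DependsOn (fun c => F c * if v ∈ A c then 1 else 0) (Set.Iio n) := fun x y h => by
    simp only [hF h, hA h]
  have hFA' (v : Fin (n + 1)) : DependsOn (fun c : (m : ℕ) → Fin (m + 1) =>
      F c * (if v ∈ A c then 1 else 0) * if c n = v then 1 else 0) (Set.Iio (n + 1)) :=
    fun x y h => by
      have h' : ∀ m ∈ Set.Iio n, x m = y m := fun m hm =>
        h m (Set.mem_Iio.2 (hm.trans n.lt_succ_self))
      simp only [hF h', hA h', h n (by simp)]
  have h1 (ω : Ω) : F (fun m => C m ω) * (if C n ω ∈ A (fun m => C m ω) then 1 else 0) =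
      ∑ v, F (fun m => C m ω) * (if v ∈ A (fun m => C m ω) then 1 else 0) *
        if C n ω = v then 1 else 0 := by
    simp
  have h2 (ω : Ω) : F (fun m => C m ω) * ((A fun m => C m ω).card / ((n : ℝ) + 1)) =
      ∑ v, F (fun m => C m ω) * (if v ∈ A (fun m => C m ω) then 1 else 0) *
        (1 / ((n : ℝ) + 1)) := by
    rw [← Finset.sum_mul, ← Finset.mul_sum]
    simp
    ring
  simp_rw [h1, h2]
  rw [integral_finsetSum _ fun v _ => integrable_of_dependsOn hC (hFA' v),
    integral_finsetSum _ fun v _ => (integrable_of_dependsOn hC (hFA v)).mul_const _]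
  refine Finset.sum_congr rfl fun v _ => ?_
  rw [integral_mul_indicator_eq hC (hFA v) v, integral_mul_const]

/-- The second moment of a centred sum grows by at most the conditional mean of the new term. -/
theorem integral_mul_add_sq_le (hC : IsUniformChoice μ C) {n : ℕ}
    {F S : ((m : ℕ) → Fin (m + 1)) → ℝ} (hF : DependsOn F (Set.Iio n)) (hF0 : ∀ c, 0 ≤ F c)
    (hS : DependsOn S (Set.Iio n))
    {A : ((m : ℕ) → Fin (m + 1)) → Finset (Fin (n + 1))} (hA : DependsOn A (Set.Iio n)) :
    ∫ ω, F (fun m => C m ω) * (S (fun m => C m ω) + (if C n ω ∈ A (fun m => C m ω) then 1 else 0) -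
        (A fun m => C m ω).card / ((n : ℝ) + 1)) ^ 2 ∂μ ≤
      (∫ ω, F (fun m => C m ω) * S (fun m => C m ω) ^ 2 ∂μ) +
        ∫ ω, F (fun m => C m ω) * ((A fun m => C m ω).card / ((n : ℝ) + 1)) ∂μ := by
  set p : ((m : ℕ) → Fin (m + 1)) → ℝ := fun c => (A c).card / ((n : ℝ) + 1) with hp
  have hpd : DependsOn p (Set.Iio n) := fun x y h => by simp only [hp, hA h]
  have hG1 : DependsOn (fun c => F c * (S c - p c) ^ 2) (Set.Iio n) := fun x y h => by
    simp only [hF h, hS h, hpd h]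
  have hG2 : DependsOn (fun c => F c * (2 * (S c - p c) + 1)) (Set.Iio n) := fun x y h => by
    simp only [hF h, hS h, hpd h]
  have hG3 : DependsOn (fun c => F c * (2 * (S c - p c) + 1) * p c) (Set.Iio n) :=
    fun x y h => by simp only [hF h, hS h, hpd h]
  have hG4 : DependsOn (fun c => F c * S c ^ 2) (Set.Iio n) := fun x y h => by
    simp only [hF h, hS h]
  have hG5 : DependsOn (fun c => F c * p c) (Set.Iio n) := fun x y h => by
    simp only [hF h, hpd h]
  have hG6 : DependsOn (fun c : (m : ℕ) → Fin (m + 1) =>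
      F c * (2 * (S c - p c) + 1) * if c n ∈ A c then 1 else 0) (Set.Iio (n + 1)) :=
    fun x y h => by
      have h' : ∀ m ∈ Set.Iio n, x m = y m := fun m hm =>
        h m (Set.mem_Iio.2 (hm.trans n.lt_succ_self))
      simp only [hF h', hS h', hpd h', hA h', h n (by simp)]
  -- An indicator equals its square, so the square is affine in it.
  have hsplit (ω : Ω) : F (fun m => C m ω) * (S (fun m => C m ω) +
      (if C n ω ∈ A (fun m => C m ω) then 1 else 0) - p fun m => C m ω) ^ 2 =
      F (fun m => C m ω) * (S (fun m => C m ω) - p fun m => C m ω) ^ 2 +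
      F (fun m => C m ω) * (2 * (S (fun m => C m ω) - p fun m => C m ω) + 1) *
        if C n ω ∈ A (fun m => C m ω) then 1 else 0 := by
    split_ifs <;> ring
  change ∫ ω, F (fun m => C m ω) * (S (fun m => C m ω) +
      (if C n ω ∈ A (fun m => C m ω) then 1 else 0) - p fun m => C m ω) ^ 2 ∂μ ≤
      (∫ ω, F (fun m => C m ω) * S (fun m => C m ω) ^ 2 ∂μ) +
        ∫ ω, F (fun m => C m ω) * (p fun m => C m ω) ∂μ
  simp_rw [hsplit]
  rw [integral_add (integrable_of_dependsOn hC hG1) (integrable_of_dependsOn hC hG6),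
    integral_mul_indicator_mem hC hG2 hA,
    ← integral_add (integrable_of_dependsOn hC hG1) (integrable_of_dependsOn hC hG3),
    ← integral_add (integrable_of_dependsOn hC hG4) (integrable_of_dependsOn hC hG5)]
  refine integral_mono ((integrable_of_dependsOn hC hG1).add (integrable_of_dependsOn hC hG3))
    ((integrable_of_dependsOn hC hG4).add (integrable_of_dependsOn hC hG5)) fun ω => ?_
  have := hF0 fun m => C m ω
  -- After averaging, the cross terms cancel and the two sides differ by exactly `F * p ^ 2`.
  nlinarith [mul_nonneg this (sq_nonneg (p fun m => C m ω))]

end Expectation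

/-! ### Harmonic sums and the two noise terms -/

/-- The harmonic numbers as real numbers. -/
noncomputable def hsum (n : ℕ) : ℝ := ∑ m ∈ Finset.range n, 1 / ((m : ℝ) + 1)

theorem hsum_zero : hsum 0 = 0 := by simp [hsum]

theorem hsum_succ (n : ℕ) : hsum (n + 1) = hsum n + 1 / ((n : ℝ) + 1) :=
  Finset.sum_range_succ _ _

theorem hsum_nonneg (n : ℕ) : 0 ≤ hsum n := Finset.sum_nonneg fun _ _ => by positivity

theorem hsum_mono : Monotone hsum := monotone_nat_of_le_succ fun n => by
  rw [hsum_succ]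
  have : 0 ≤ 1 / ((n : ℝ) + 1) := by positivity
  linarith

theorem one_le_hsum {n : ℕ} (hn : 1 ≤ n) : 1 ≤ hsum n :=
  le_trans (by simp [hsum]) (hsum_mono hn)

theorem hsum_eq_harmonic (n : ℕ) : hsum n = (harmonic n : ℝ) := by
  simp [hsum, harmonic]

theorem log_succ_le_hsum (n : ℕ) : Real.log (n + 1) ≤ hsum n := by
  rw [hsum_eq_harmonic]
  exact_mod_cast log_add_one_le_harmonic n

theorem hsum_le_one_add_log (n : ℕ) : hsum n ≤ 1 + Real.log n := by
  rw [hsum_eq_harmonic]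
  exact harmonic_le_one_add_log n

/-- The centred number of vertices of depth `k + 1`. -/
noncomputable def widthNoise (c : (m : ℕ) → Fin (m + 1)) (k n : ℕ) : ℝ :=
  width c (k + 1) n - ∑ m ∈ Finset.range n, width c k m / ((m : ℝ) + 1)

/-- The sum, over the vertices of depth `k`, of the squared deviation of the number of children
from its mean. -/
noncomputable def childrenNoise (c : (m : ℕ) → Fin (m + 1)) (k n : ℕ) : ℝ :=
  ∑ i ∈ Finset.range (n + 1),
    (if depth c i = k then 1 else 0) * (children c n i - (hsum n - hsum i)) ^ 2

theorem dependsOn_width (k n : ℕ) : DependsOn (fun c => (width c k n : ℝ)) (Set.Iio n) :=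
  fun x y h => by simp only [width_congr k n h]

theorem dependsOn_depth {i n : ℕ} (k : ℕ) (hi : i ≤ n) :
    DependsOn (fun c => if depth c i = k then (1 : ℝ) else 0) (Set.Iio n) :=
  fun x y h => by simp only [depth_congr i fun m hm => h m (Set.mem_Iio.2 (by omega))]

theorem dependsOn_widthNoise (k n : ℕ) : DependsOn (fun c => widthNoise c k n) (Set.Iio n) :=
  fun x y h => by
    simp only [widthNoise, width_congr (k + 1) n h]
    congr 1
    refine Finset.sum_congr rfl fun m hm => ?_
    rw [width_congr k m fun l hl => h l (Set.mem_Iio.2 (hl.trans (Finset.mem_range.1 hm)))]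

theorem dependsOn_childrenDeviation (n i : ℕ) :
    DependsOn (fun c => (children c n i : ℝ) - (hsum n - hsum i)) (Set.Iio n) :=
  fun x y h => by simp only [children_congr n i h]

theorem dependsOn_childrenTerm (k : ℕ) {n i : ℕ} (hi : i ≤ n) : DependsOn (fun c =>
    (if depth c i = k then (1 : ℝ) else 0) * (children c n i - (hsum n - hsum i)) ^ 2)
    (Set.Iio n) :=
  fun x y h => by
    simp only [dependsOn_childrenDeviation n i h, dependsOn_depth k hi h]

theorem dependsOn_childrenNoise (k n : ℕ) :
    DependsOn (fun c => childrenNoise c k n) (Set.Iio n) :=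
  fun x y h => Finset.sum_congr rfl fun i hi =>
    dependsOn_childrenTerm k (by have := Finset.mem_range.1 hi; omega) h

theorem childrenNoise_nonneg (c : (m : ℕ) → Fin (m + 1)) (k n : ℕ) : 0 ≤ childrenNoise c k n :=
  Finset.sum_nonneg fun i _ => by split_ifs <;> positivity

/-- The vertices of depth `k` among the possible parents of the next vertex. -/
def parents (k n : ℕ) (c : (m : ℕ) → Fin (m + 1)) : Finset (Fin (n + 1)) :=
  Finset.univ.filter fun v : Fin (n + 1) => depth c v = k

theorem dependsOn_parents (k n : ℕ) : DependsOn (parents k n) (Set.Iio n) := fun x y h =>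
  Finset.filter_congr fun v _ => by
    rw [depth_congr (v : ℕ) fun m hm => h m (Set.mem_Iio.2 (by have := v.isLt; omega))]

theorem card_parents (k n : ℕ) (c : (m : ℕ) → Fin (m + 1)) :
    (parents k n c).card = width c k n := card_filter_depth_eq_width c k n

theorem mem_parents {k n : ℕ} {c : (m : ℕ) → Fin (m + 1)} {v : Fin (n + 1)} :
    v ∈ parents k n c ↔ depth c v = k := by simp [parents]

/-! ### Moment bounds and almost sure limits along sparse times -/

section Moments

variable {Ω : Type*} [MeasurableSpace Ω] {μ : Measure Ω} [IsProbabilityMeasure μ]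
  {C : (m : ℕ) → Ω → Fin (m + 1)}

theorem integral_width_succ_succ (hC : IsUniformChoice μ C) (k n : ℕ) :
    ∫ ω, (width (fun m => C m ω) (k + 1) (n + 1) : ℝ) ∂μ =
      (∫ ω, (width (fun m => C m ω) (k + 1) n : ℝ) ∂μ) +
        (∫ ω, (width (fun m => C m ω) k n : ℝ) ∂μ) / ((n : ℝ) + 1) := by
  have h1 : DependsOn (fun _ : (m : ℕ) → Fin (m + 1) => (1 : ℝ)) (Set.Iio n) := fun x y h => rfl
  have h2 := integral_mul_indicator_mem hC h1 (dependsOn_parents k n)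
  simp only [one_mul, mem_parents, card_parents] at h2
  have h3 : Integrable (fun ω => if depth (fun m => C m ω) (C n ω) = k then (1 : ℝ) else 0) μ := by
    refine integrable_of_dependsOn hC (n := n + 1)
      (F := fun c => if depth c (c n) = k then (1 : ℝ) else 0) fun x y h => ?_
    have hn := h n (by simp)
    have := (x n).isLt
    simp only [hn] at this ⊢
    rw [depth_congr (y n : ℕ) fun m hm => h m (Set.mem_Iio.2 (by omega))]
  simp_rw [width_succ_succ, Nat.cast_add, Nat.cast_ite, Nat.cast_one, Nat.cast_zero]
  rw [integral_add (integrable_of_dependsOn hC (dependsOn_width (k + 1) n)) h3, h2,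
    integral_div]

theorem integral_width_succ (hC : IsUniformChoice μ C) (k n : ℕ) :
    ∫ ω, (width (fun m => C m ω) (k + 1) n : ℝ) ∂μ =
      ∑ m ∈ Finset.range n, (∫ ω, (width (fun m => C m ω) k m : ℝ) ∂μ) / ((m : ℝ) + 1) := by
  induction n with
  | zero => simp [width_succ_zero]
  | succ n ih => rw [integral_width_succ_succ hC, ih, Finset.sum_range_succ]

theorem integral_width_le (hC : IsUniformChoice μ C) (k n : ℕ) :
    ∫ ω, (width (fun m => C m ω) k n : ℝ) ∂μ ≤ hsum n ^ k := by
  induction k generalizing n with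
  | zero => simp [width_zero]
  | succ k ih =>
    rw [integral_width_succ hC, pow_succ]
    nth_rw 2 [hsum]
    rw [Finset.mul_sum]
    refine Finset.sum_le_sum fun m hm => ?_
    rw [mul_one_div]
    gcongr
    exact (ih m).trans (pow_le_pow_left₀ (hsum_nonneg m)
      (hsum_mono (Finset.mem_range.1 hm).le) k)

/-- The noise is a martingale with centred indicator increments, so its second moment is at most the
sum of their means, which is the mean of `width (k + 1) n`. -/
theorem integral_widthNoise_sq_le (hC : IsUniformChoice μ C) (k n : ℕ) :
    ∫ ω, widthNoise (fun m => C m ω) k n ^ 2 ∂μ ≤ hsum n ^ (k + 1) := by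
  refine le_trans ?_ (integral_width_le hC (k + 1) n)
  induction n with
  | zero => simp [widthNoise, width_succ_zero]
  | succ n ih =>
    have h1 : DependsOn (fun _ : (m : ℕ) → Fin (m + 1) => (1 : ℝ)) (Set.Iio n) :=
      fun x y h => rfl
    have h2 := integral_mul_add_sq_le hC h1 (fun _ => zero_le_one) (dependsOn_widthNoise k n)
      (dependsOn_parents k n)
    simp only [one_mul, mem_parents, card_parents] at h2
    rw [integral_width_succ_succ hC, ← integral_div]
    refine le_trans (le_of_eq ?_) (h2.trans (add_le_add_left ih _))
    congr 1
    ext ω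
    simp only [widthNoise, width_succ_succ, Finset.sum_range_succ, Nat.cast_add, Nat.cast_ite,
      Nat.cast_one, Nat.cast_zero]
    ring

/-- The depth of `i` is settled by time `i`, so it serves as a fixed weight while later children
accumulate; the variance of a sum of independent indicators is at most its mean. -/
theorem integral_childrenTerm_le (hC : IsUniformChoice μ C) (k i n : ℕ) (hi : i ≤ n) :
    ∫ ω, (if depth (fun m => C m ω) i = k then (1 : ℝ) else 0) *
        (children (fun m => C m ω) n i - (hsum n - hsum i)) ^ 2 ∂μ ≤
      (∫ ω, (if depth (fun m => C m ω) i = k then (1 : ℝ) else 0) ∂μ) * (hsum n - hsum i) := by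
  induction n, hi using Nat.le_induction with
  | base => simp [children_self]
  | succ n hn ih =>
    set A : ((m : ℕ) → Fin (m + 1)) → Finset (Fin (n + 1)) := fun _ => {⟨i, by omega⟩} with hA
    have hAd : DependsOn A (Set.Iio n) := fun x y h => rfl
    have h2 := integral_mul_add_sq_le hC (dependsOn_depth k hn)
      (fun c => by split_ifs <;> positivity) (dependsOn_childrenDeviation n i) hAd
    simp only [hA, Finset.mem_singleton, Finset.card_singleton, Nat.cast_one] at h2
    rw [integral_mul_const] at h2
    rw [hsum_succ, add_sub_right_comm, mul_add]
    refine le_trans (le_of_eq ?_) (h2.trans (add_le_add_left ih _))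
    congr 1
    ext ω
    simp only [children_succ, Nat.cast_add, Nat.cast_ite, Nat.cast_one, Nat.cast_zero, Fin.ext_iff]
    ring

theorem integral_childrenNoise_le (hC : IsUniformChoice μ C) (k n : ℕ) :
    ∫ ω, childrenNoise (fun m => C m ω) k n ∂μ ≤ hsum n ^ (k + 1) := by
  unfold childrenNoise
  have hle (i) (hi : i ∈ Finset.range (n + 1)) : i ≤ n := by
    have := Finset.mem_range.1 hi
    omega
  rw [integral_finsetSum _ fun i hi =>
    integrable_of_dependsOn hC (dependsOn_childrenTerm k (hle i hi))]
  calc _ ≤ ∑ i ∈ Finset.range (n + 1),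
        (∫ ω, (if depth (fun m => C m ω) i = k then (1 : ℝ) else 0) ∂μ) * hsum n := by
        refine Finset.sum_le_sum fun i hi =>
          (integral_childrenTerm_le hC k i n (hle i hi)).trans ?_
        refine mul_le_mul_of_nonneg_left (by linarith [hsum_nonneg i]) ?_
        exact integral_nonneg fun ω => by dsimp only; split_ifs <;> positivity
    _ = (∫ ω, (width (fun m => C m ω) k n : ℝ) ∂μ) * hsum n := by
        rw [← Finset.sum_mul, ← integral_finsetSum _ fun i hi =>
          integrable_of_dependsOn hC (dependsOn_depth k (hle i hi))]
        simp [width]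
    _ ≤ hsum n ^ (k + 1) := by
        rw [pow_succ]
        exact mul_le_mul_of_nonneg_right (integral_width_le hC k n) (hsum_nonneg n)

omit [IsProbabilityMeasure μ] in
theorem ae_tendsto_zero_of_summable_integral {Y : ℕ → Ω → ℝ} (hint : ∀ j, Integrable (Y j) μ)
    (h0 : ∀ j ω, 0 ≤ Y j ω) {b : ℕ → ℝ} (hb : ∀ j, ∫ ω, Y j ω ∂μ ≤ b j) (hsum : Summable b) :
    ∀ᵐ ω ∂μ, Tendsto (fun j => Y j ω) atTop (𝓝 0) := by
  have hfin : ∫⁻ ω, ∑' j, ENNReal.ofReal (Y j ω) ∂μ ≠ ⊤ := by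
    rw [lintegral_tsum fun j => (hint j).aemeasurable.ennreal_ofReal]
    simp_rw [← ofReal_integral_eq_lintegral_ofReal (hint _) (ae_of_all _ (h0 _))]
    exact (Summable.of_nonneg_of_le (fun j => integral_nonneg (h0 j)) hb hsum).tsum_ofReal_ne_top
  filter_upwards [ae_lt_top' (AEMeasurable.tsum fun j =>
    (hint j).aemeasurable.ennreal_ofReal) hfin] with ω hω
  have := ENNReal.tendsto_atTop_zero_of_tsum_ne_top hω.ne
  have h2 := (ENNReal.tendsto_toReal ENNReal.zero_ne_top).comp this
  simpa [Function.comp_def, ENNReal.toReal_ofReal (h0 _ _)] using h2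

/-- Sparse times, along which the moment bounds are summable. -/
def sparse (j : ℕ) : ℕ := 2 ^ j ^ 2

theorem one_le_sparse (j : ℕ) : 1 ≤ sparse j := Nat.one_le_two_pow

theorem log_sparse (j : ℕ) : Real.log (sparse j) = (j : ℝ) ^ 2 * Real.log 2 := by
  simp [sparse, Real.log_pow]

theorem sq_mul_log_two_le_hsum_sparse (j : ℕ) : (j : ℝ) ^ 2 * Real.log 2 ≤ hsum (sparse j) := by
  rw [← log_sparse]
  refine le_trans (Real.log_le_log ?_ (by linarith)) (log_succ_le_hsum _)
  exact_mod_cast one_le_sparse j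

/-- One extra power of `hsum` leaves a mean of at most `1 / hsum (sparse j)`, of order `1 / j ^ 2`,
which is summable. -/
theorem ae_tendsto_zero_sparse (hC : IsUniformChoice μ C) {R : ((m : ℕ) → Fin (m + 1)) → ℕ → ℝ}
    (hR : ∀ n, DependsOn (fun c => R c n) (Set.Iio n)) (h0 : ∀ c n, 0 ≤ R c n) {a : ℕ}
    (ha : ∀ n, ∫ ω, R (fun m => C m ω) n ∂μ ≤ hsum n ^ a) :
    ∀ᵐ ω ∂μ, Tendsto (fun j => R (fun m => C m ω) (sparse j) / hsum (sparse j) ^ (a + 1))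
      atTop (𝓝 0) := by
  -- The shift to `j + 1` avoids `j = 0`, where the bound would read `1 / 0 = 0`.
  have key := ae_tendsto_zero_of_summable_integral (μ := μ)
    (Y := fun j ω => R (fun m => C m ω) (sparse (j + 1)) / hsum (sparse (j + 1)) ^ (a + 1))
    (b := fun j : ℕ => (Real.log 2)⁻¹ * (1 / ((j + 1 : ℕ) : ℝ) ^ 2))
    (fun j => (integrable_of_dependsOn hC (hR _)).div_const _)
    (fun j ω => div_nonneg (h0 _ _) (pow_nonneg (hsum_nonneg _) _)) (fun j => ?_) ?_
  · filter_upwards [key] with ω hω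
    exact (tendsto_add_atTop_iff_nat 1).1 hω
  · have h1 : 0 < hsum (sparse (j + 1)) := zero_lt_one.trans_le (one_le_hsum (one_le_sparse _))
    have hl : 0 < Real.log 2 := Real.log_pos one_lt_two
    rw [integral_div]
    calc _ ≤ hsum (sparse (j + 1)) ^ a / hsum (sparse (j + 1)) ^ (a + 1) := by
          gcongr
          exact ha _
      _ = (hsum (sparse (j + 1)))⁻¹ := by
          rw [pow_succ]
          field_simp
      _ ≤ (((j + 1 : ℕ) : ℝ) ^ 2 * Real.log 2)⁻¹ := by
          gcongr
          exact sq_mul_log_two_le_hsum_sparse _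
      _ = _ := by field_simp
  · exact ((summable_nat_add_iff 1).2 (Real.summable_one_div_nat_pow.2 one_lt_two)).mul_left _

theorem ae_tendsto_widthNoise (hC : IsUniformChoice μ C) (k : ℕ) :
    ∀ᵐ ω ∂μ, Tendsto (fun j => widthNoise (fun m => C m ω) k (sparse j) /
      hsum (sparse j) ^ (k + 1)) atTop (𝓝 0) := by
  filter_upwards [ae_tendsto_zero_sparse hC (R := fun c n => widthNoise c k n ^ 2)
    (fun n x y h => by simp only [dependsOn_widthNoise k n h]) (fun _ _ => sq_nonneg _)
    (integral_widthNoise_sq_le hC k)] with ω hω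
  have h1 : Tendsto (fun j => (widthNoise (fun m => C m ω) k (sparse j) /
      hsum (sparse j) ^ (k + 1)) ^ 2) atTop (𝓝 0) := by
    refine squeeze_zero (fun _ => sq_nonneg _) (fun j => ?_) hω
    have h1 : 1 ≤ hsum (sparse j) := one_le_hsum (one_le_sparse _)
    -- As `hsum ≥ 1` at sparse times, the exponent `2 * (k + 1)` may be lowered to `k + 2`.
    rw [div_pow, ← pow_mul]
    gcongr
    omega
  have h2 := h1.sqrt
  simp only [Real.sqrt_sq_eq_abs, Real.sqrt_zero] at h2
  exact (tendsto_zero_iff_abs_tendsto_zero _).2 h2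

theorem ae_tendsto_childrenNoise (hC : IsUniformChoice μ C) (k : ℕ) :
    ∀ᵐ ω ∂μ, Tendsto (fun j => childrenNoise (fun m => C m ω) k (sparse j) /
      hsum (sparse j) ^ (k + 2)) atTop (𝓝 0) :=
  ae_tendsto_zero_sparse hC (dependsOn_childrenNoise k) (fun c n => childrenNoise_nonneg c k n)
    (integral_childrenNoise_le hC k)

end Moments

/-! ### Asymptotics of harmonic sums and interpolation -/

theorem log_le_hsum (n : ℕ) : Real.log n ≤ hsum n := by
  rcases n.eq_zero_or_pos with rfl | hn
  · simp [hsum_zero]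
  · exact (Real.log_le_log (by exact_mod_cast hn) (by linarith)).trans (log_succ_le_hsum n)

theorem tendsto_log_natCast : Tendsto (fun n : ℕ => Real.log n) atTop atTop :=
  Real.tendsto_log_atTop.comp tendsto_natCast_atTop_atTop

theorem tendsto_hsum : Tendsto hsum atTop atTop :=
  tendsto_atTop_mono log_le_hsum tendsto_log_natCast

theorem eventually_hsum_pos : ∀ᶠ n in atTop, 0 < hsum n := tendsto_hsum.eventually_gt_atTop 0

theorem tendsto_log_div_hsum : Tendsto (fun n : ℕ => Real.log n / hsum n) atTop (𝓝 1) := by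
  have h1 : Tendsto (fun n => 1 - 1 / hsum n) atTop (𝓝 1) := by
    simpa using (tendsto_hsum.inv_tendsto_atTop).const_sub 1
  refine tendsto_of_tendsto_of_tendsto_of_le_of_le' h1 tendsto_const_nhds ?_ ?_
  · filter_upwards [eventually_hsum_pos] with n hn
    rw [le_div_iff₀ hn, sub_mul, one_div_mul_cancel hn.ne']
    linarith [hsum_le_one_add_log n]
  · filter_upwards [eventually_hsum_pos] with n hn
    exact (div_le_one hn).2 (log_le_hsum n)

theorem tendsto_sparse : Tendsto sparse atTop atTop :=
  (tendsto_pow_atTop_atTop_of_one_lt one_lt_two).comp (tendsto_pow_atTop two_ne_zero)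

/-- `hsum (sparse j)` is asymptotic to `j ^ 2 * log 2`: fast enough for summable inverses, slow
enough for consecutive ratios to tend to 1. -/
theorem tendsto_hsum_sparse_succ_div :
    Tendsto (fun j => hsum (sparse (j + 1)) / hsum (sparse j)) atTop (𝓝 1) := by
  have h1 := tendsto_log_div_hsum.comp tendsto_sparse
  have h2 := (tendsto_add_atTop_iff_nat 1).2 h1
  have h3 : Tendsto (fun j : ℕ => (((j : ℝ) + 1) / j) ^ 2) atTop (𝓝 1) := by
    have : Tendsto (fun j : ℕ => 1 + 1 / (j : ℝ)) atTop (𝓝 1) := by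
      simpa using tendsto_one_div_atTop_nhds_zero_nat.const_add (1 : ℝ)
    have h4 := this.pow 2
    rw [one_pow] at h4
    refine h4.congr' ?_
    filter_upwards [eventually_gt_atTop 0] with j hj
    have : (0 : ℝ) < j := by exact_mod_cast hj
    field_simp
  have h5 := (h1.div h2 one_ne_zero).mul h3
  rw [div_one, mul_one] at h5
  refine h5.congr' ?_
  filter_upwards [eventually_gt_atTop 0] with j hj
  have hj' : (0 : ℝ) < j := by exact_mod_cast hj
  have hl : 0 < Real.log 2 := Real.log_pos one_lt_two
  have ha : 0 < hsum (sparse j) := zero_lt_one.trans_le (one_le_hsum (one_le_sparse _))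
  have hb : 0 < hsum (sparse (j + 1)) := zero_lt_one.trans_le (one_le_hsum (one_le_sparse _))
  simp only [Pi.div_apply, Function.comp_apply, log_sparse, Nat.cast_add, Nat.cast_one]
  field_simp

/-- The index of the last sparse time up to `n`. -/
def sparseIndex (n : ℕ) : ℕ := Nat.sqrt (Nat.log 2 n)

theorem tendsto_sparseIndex : Tendsto sparseIndex atTop atTop :=
  tendsto_atTop_atTop.2 fun b => ⟨2 ^ b ^ 2, fun _ hn =>
    Nat.le_sqrt'.2 (Nat.le_log_of_pow_le one_lt_two hn)⟩

theorem sparse_sparseIndex_le {n : ℕ} (hn : 1 ≤ n) : sparse (sparseIndex n) ≤ n :=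
  (Nat.pow_le_pow_right two_pos (Nat.sqrt_le' _)).trans (Nat.pow_log_le_self 2 (by omega))

theorem le_sparse_sparseIndex_succ (n : ℕ) : n ≤ sparse (sparseIndex n + 1) :=
  (Nat.lt_pow_succ_log_self one_lt_two n).le.trans
    (Nat.pow_le_pow_right two_pos (Nat.lt_succ_sqrt' _))

theorem tendsto_hsum_sparse_div_hsum :
    Tendsto (fun n => hsum (sparse (sparseIndex n)) / hsum n) atTop (𝓝 1) := by
  have h := (tendsto_hsum_sparse_succ_div.comp tendsto_sparseIndex).inv₀ one_ne_zero
  rw [inv_one] at h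
  refine tendsto_of_tendsto_of_tendsto_of_le_of_le' h tendsto_const_nhds ?_ ?_
  · filter_upwards [eventually_hsum_pos] with n hn
    rw [Function.comp_apply, inv_div]
    gcongr
    · exact hsum_nonneg _
    · exact hsum_mono (le_sparse_sparseIndex_succ n)
  · filter_upwards [eventually_hsum_pos, eventually_ge_atTop 1] with n hn hn1
    exact (div_le_one hn).2 (hsum_mono (sparse_sparseIndex_le hn1))

theorem tendsto_hsum_sparse_succ_div_hsum :
    Tendsto (fun n => hsum (sparse (sparseIndex n + 1)) / hsum n) atTop (𝓝 1) := by
  have h := (tendsto_hsum_sparse_succ_div.comp tendsto_sparseIndex).mul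
    tendsto_hsum_sparse_div_hsum
  rw [mul_one] at h
  refine h.congr fun n => ?_
  have ha : 0 < hsum (sparse (sparseIndex n)) :=
    zero_lt_one.trans_le (one_le_hsum (one_le_sparse _))
  rw [Function.comp_apply]
  field_simp

theorem tendsto_div_hsum_pow_comp {u : ℕ → ℝ} {k : ℕ} {L a : ℝ} {N M : ℕ → ℕ}
    (hu : Tendsto (fun n => u (N n) / hsum (N n) ^ k) atTop (𝓝 L))
    (hN : Tendsto N atTop atTop)
    (hNM : Tendsto (fun n => hsum (N n) / hsum (M n)) atTop (𝓝 a)) :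
    Tendsto (fun n => u (N n) / hsum (M n) ^ k) atTop (𝓝 (L * a ^ k)) := by
  refine (hu.mul (hNM.pow k)).congr' ?_
  filter_upwards [hN.eventually eventually_hsum_pos] with n hn
  rw [div_pow]
  field_simp

theorem tendsto_sparse_sparseIndex : Tendsto (fun n => sparse (sparseIndex n)) atTop atTop :=
  tendsto_sparse.comp tendsto_sparseIndex

theorem tendsto_sparseIndex_succ : Tendsto (fun n => sparseIndex n + 1) atTop atTop :=
  (tendsto_add_atTop_nat 1).comp tendsto_sparseIndex

theorem tendsto_sparse_sparseIndex_succ :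
    Tendsto (fun n => sparse (sparseIndex n + 1)) atTop atTop :=
  tendsto_sparse.comp tendsto_sparseIndex_succ

/-- Sandwich `u n` between its values at the neighbouring sparse times, where changing the
normalisation to `hsum n` costs a factor tending to 1. -/
theorem tendsto_div_hsum_pow_of_sparse {u : ℕ → ℝ} (hu : Monotone u) {k : ℕ} {L : ℝ}
    (h : Tendsto (fun j => u (sparse j) / hsum (sparse j) ^ k) atTop (𝓝 L)) :
    Tendsto (fun n => u n / hsum n ^ k) atTop (𝓝 L) := by
  have h1 := tendsto_div_hsum_pow_comp (h.comp tendsto_sparseIndex) tendsto_sparse_sparseIndex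
    tendsto_hsum_sparse_div_hsum
  have h2 := tendsto_div_hsum_pow_comp (h.comp tendsto_sparseIndex_succ)
    tendsto_sparse_sparseIndex_succ tendsto_hsum_sparse_succ_div_hsum
  rw [one_pow, mul_one] at h1 h2
  refine tendsto_of_tendsto_of_tendsto_of_le_of_le' h1 h2 ?_ ?_
  · filter_upwards [eventually_ge_atTop 1] with n hn
    exact div_le_div_of_nonneg_right (hu (sparse_sparseIndex_le hn)) (pow_nonneg (hsum_nonneg n) k)
  · exact Eventually.of_forall fun n =>
      div_le_div_of_nonneg_right (hu (le_sparse_sparseIndex_succ n)) (pow_nonneg (hsum_nonneg n) k)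

theorem tendsto_hsum_succ_div : Tendsto (fun n => hsum (n + 1) / hsum n) atTop (𝓝 1) := by
  have h : Tendsto (fun n : ℕ => 1 + 1 / ((n : ℝ) + 1) * (hsum n)⁻¹) atTop (𝓝 1) := by
    simpa using (tendsto_one_div_add_atTop_nhds_zero_nat.mul
      tendsto_hsum.inv_tendsto_atTop).const_add (1 : ℝ)
  refine h.congr' ?_
  filter_upwards [eventually_hsum_pos] with n hn
  rw [hsum_succ]
  field_simp

theorem tendsto_hsum_pow_sub_pow (k : ℕ) :
    Tendsto (fun n : ℕ => (hsum (n + 1) ^ (k + 1) - hsum n ^ (k + 1)) * ((n : ℝ) + 1) / hsum n ^ k)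
      atTop (𝓝 ((k : ℝ) + 1)) := by
  have h : Tendsto (fun n => ∑ i ∈ Finset.range (k + 1), (hsum (n + 1) / hsum n) ^ i) atTop
      (𝓝 (∑ i ∈ Finset.range (k + 1), (1 : ℝ) ^ i)) :=
    tendsto_finsetSum _ fun i _ => tendsto_hsum_succ_div.pow i
  simp only [one_pow, Finset.sum_const, Finset.card_range, nsmul_eq_mul, mul_one, Nat.cast_add,
    Nat.cast_one] at h
  refine h.congr' ?_
  filter_upwards [eventually_hsum_pos] with n hn
  rw [← geom_sum₂_mul, hsum_succ n, add_sub_cancel_left, mul_assoc,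
    one_div_mul_cancel (by positivity), mul_one, Finset.sum_div]
  refine Finset.sum_congr rfl fun i hi => ?_
  have hi' : k + 1 - 1 - i + i = k := by
    have := Finset.mem_range.1 hi
    omega
  rw [div_pow, div_eq_div_iff (by positivity) (by positivity)]
  nth_rw 1 [← hi']
  ring

/-- Stolz–Cesàro: the increments of `hsum ^ (k + 1)` are asymptotic to `(k + 1) * hsum n ^ k / (n +
1)`, and they telescope. -/
theorem tendsto_sum_div_hsum_pow {u : ℕ → ℝ} {k : ℕ} {L : ℝ}
    (h : Tendsto (fun n => u n / hsum n ^ k) atTop (𝓝 L)) :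
    Tendsto (fun n => (∑ m ∈ Finset.range n, u m / ((m : ℝ) + 1)) / hsum n ^ (k + 1)) atTop
      (𝓝 (L / ((k : ℝ) + 1))) := by
  set g : ℕ → ℝ := fun n => hsum (n + 1) ^ (k + 1) - hsum n ^ (k + 1) with hg
  have hgpos (n : ℕ) : 0 < g n := by
    refine sub_pos.2 (pow_lt_pow_left₀ ?_ (hsum_nonneg n) k.succ_ne_zero)
    rw [hsum_succ]
    have : 0 < 1 / ((n : ℝ) + 1) := by positivity
    linarith
  have hgsum (n : ℕ) : ∑ i ∈ Finset.range n, g i = hsum n ^ (k + 1) := by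
    rw [hg, Finset.sum_range_sub (fun n => hsum n ^ (k + 1)), hsum_zero]
    simp
  have hk : (k : ℝ) + 1 ≠ 0 := by positivity
  have hratio : Tendsto (fun n : ℕ => u n / ((n : ℝ) + 1) / g n) atTop
      (𝓝 (L / ((k : ℝ) + 1))) := by
    refine (h.div (tendsto_hsum_pow_sub_pow k) hk).congr' ?_
    filter_upwards [eventually_hsum_pos] with n hn
    have h1 := (hgpos n).ne'
    change u n / hsum n ^ k / (g n * ((n : ℝ) + 1) / hsum n ^ k) = _
    field_simp
  have ho : (fun n : ℕ => u n / ((n : ℝ) + 1) - L / ((k : ℝ) + 1) * g n) =o[atTop] g := by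
    refine (Asymptotics.isLittleO_iff_tendsto fun n hn => absurd hn (hgpos n).ne').2 ?_
    have := hratio.sub_const (L / ((k : ℝ) + 1))
    rw [sub_self] at this
    refine this.congr fun n => ?_
    rw [sub_div, mul_div_cancel_right₀ _ (hgpos n).ne']
  have hsumo := (ho.sum_range (fun n => (hgpos n).le) (by
    simp_rw [hgsum]
    exact (tendsto_pow_atTop k.succ_ne_zero).comp tendsto_hsum)).tendsto_div_nhds_zero
  simp_rw [Finset.sum_sub_distrib, ← Finset.mul_sum, hgsum] at hsumo
  have := hsumo.add_const (L / ((k : ℝ) + 1))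
  rw [zero_add] at this
  refine this.congr' ?_
  filter_upwards [eventually_hsum_pos] with n hn
  field_simp
  ring

/-- The compensator brings a factor `1 / (k + 1)` at each level, whence the factorial; the noise
vanishes along sparse times and monotonicity does the rest. -/
theorem tendsto_width {c : (m : ℕ) → Fin (m + 1)}
    (h : ∀ k, Tendsto (fun j => widthNoise c k (sparse j) / hsum (sparse j) ^ (k + 1))
      atTop (𝓝 0)) (k : ℕ) :
    Tendsto (fun n => (width c k n : ℝ) / hsum n ^ k) atTop (𝓝 (1 / (k.factorial : ℝ))) := by
  induction k with
  | zero => simp [width_zero]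
  | succ k ih =>
    refine tendsto_div_hsum_pow_of_sparse (fun m n hmn => by exact_mod_cast width_mono c _ hmn) ?_
    have := (h k).add ((tendsto_sum_div_hsum_pow ih).comp tendsto_sparse)
    rw [zero_add] at this
    have hfac : 1 / (((k + 1).factorial : ℕ) : ℝ) = 1 / (k.factorial : ℝ) / ((k : ℝ) + 1) := by
      rw [Nat.factorial_succ, Nat.cast_mul, Nat.cast_succ, div_div, mul_comm]
    rw [hfac]
    refine this.congr fun j => ?_
    rw [Function.comp_apply, ← add_div, widthNoise, sub_add_cancel]

/-! ### Counting vertices of large degree -/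

theorem card_mul_sq_le_childrenNoise (c : (m : ℕ) → Fin (m + 1)) {k n : ℕ} {δ : ℝ} (hδ : 0 ≤ δ)
    {S : Finset ℕ} (hS : ∀ i ∈ S, i ≤ n ∧ depth c i = k ∧
      δ ≤ |(children c n i : ℝ) - (hsum n - hsum i)|) :
    S.card * δ ^ 2 ≤ childrenNoise c k n := by
  calc (S.card : ℝ) * δ ^ 2 = ∑ i ∈ S, δ ^ 2 := by simp
    _ ≤ ∑ i ∈ S, (if depth c i = k then 1 else 0) *
        ((children c n i : ℝ) - (hsum n - hsum i)) ^ 2 := by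
      refine Finset.sum_le_sum fun i hi => ?_
      rw [if_pos (hS i hi).2.1, one_mul, ← sq_abs ((children c n i : ℝ) - _)]
      exact pow_le_pow_left₀ hδ (hS i hi).2.2 2
    _ ≤ childrenNoise c k n := by
      refine Finset.sum_le_sum_of_subset_of_nonneg (fun i hi => ?_) fun i _ _ => ?_
      · exact Finset.mem_range.2 (Nat.lt_succ_of_le (hS i hi).1)
      · split_ifs <;> positivity

/-- The number of vertices of depth `k` and of degree greater than `y` after `n` steps. -/
noncomputable def largeDegCount (c : (m : ℕ) → Fin (m + 1)) (k n : ℕ) (y : ℝ) : ℕ :=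
  ((level c n k).filter fun i => y < (deg c n i : ℝ)).card

/-- A vertex born by time `K` expects at least `y + δ` children at time `N`, so having at most `y`
is a deviation of at least `δ`. Those with more than `y` keep them until `n ≥ N`. -/
theorem width_le_largeDegCount_add (c : (m : ℕ) → Fin (m + 1)) {k n N K : ℕ} (hN : N ≤ n)
    (hK : K ≤ N) {y δ : ℝ} (hδ : 0 < δ) (h : y + δ ≤ hsum N - hsum K) :
    (width c k K : ℝ) ≤ largeDegCount c k n y + childrenNoise c k N / δ ^ 2 := by
  set S := (Finset.range (K + 1)).filter fun i => depth c i = k ∧ (children c N i : ℝ) ≤ y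
  have hS : S.card * δ ^ 2 ≤ childrenNoise c k N := by
    refine card_mul_sq_le_childrenNoise c hδ.le fun i hi => ?_
    obtain ⟨h1, h2, h3⟩ := Finset.mem_filter.1 hi
    have hiK : i ≤ K := Nat.le_of_lt_succ (Finset.mem_range.1 h1)
    refine ⟨hiK.trans hK, h2, le_trans ?_ (neg_le_abs _)⟩
    linarith [hsum_mono hiK]
  have hT : ((Finset.range (n + 1)).filter fun i =>
      depth c i = k ∧ y < (children c n i : ℝ)).card ≤ largeDegCount c k n y := by
    rw [← card_filter_level c n k fun i => y < (children c n i : ℝ)]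
    refine Finset.card_le_card (Finset.monotone_filter_right _ fun i _ hi => hi.trans_le ?_)
    exact_mod_cast children_le_deg c n i
  have hle : width c k K ≤ largeDegCount c k n y + S.card := by
    refine (Finset.card_le_card fun i hi => ?_).trans
      ((Finset.card_union_le _ _).trans (Nat.add_le_add_right hT _))
    obtain ⟨h1, h2⟩ := Finset.mem_filter.1 hi
    rw [Finset.mem_union]
    rcases le_or_gt (children c N i : ℝ) y with h3 | h3
    · exact Or.inr (Finset.mem_filter.2 ⟨h1, h2, h3⟩)
    · refine Or.inl (Finset.mem_filter.2 ⟨?_, h2, h3.trans_le ?_⟩)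
      · have := Finset.mem_range.1 h1
        exact Finset.mem_range.2 (by omega)
      · exact_mod_cast children_mono c i hN
  have := (le_div_iff₀ (by positivity)).2 hS
  have h4 : (width c k K : ℝ) ≤ largeDegCount c k n y + S.card := by exact_mod_cast hle
  linarith

/-- A vertex born after `K` expects at most `y - 1 - δ` children at time `N ≥ n`, so degree above
`y` at time `n` forces a deviation of at least `δ`. The `1` pays for the parent edge. -/
theorem largeDegCount_le_width_add (c : (m : ℕ) → Fin (m + 1)) {k n N K : ℕ} (hN : n ≤ N)
    {y δ : ℝ} (hδ : 0 < δ) (h : hsum N - hsum K + 1 + δ ≤ y) :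
    (largeDegCount c k n y : ℝ) ≤ width c k K + childrenNoise c k N / δ ^ 2 := by
  set S := (Finset.range (n + 1)).filter fun i =>
    K < i ∧ depth c i = k ∧ y < (children c n i : ℝ) + 1
  have hS : S.card * δ ^ 2 ≤ childrenNoise c k N := by
    refine card_mul_sq_le_childrenNoise c hδ.le fun i hi => ?_
    obtain ⟨h1, h2, h3, h4⟩ := Finset.mem_filter.1 hi
    have hin := Finset.mem_range.1 h1
    refine ⟨by omega, h3, le_trans ?_ (le_abs_self _)⟩
    have h5 : (children c n i : ℝ) ≤ children c N i := by exact_mod_cast children_mono c i hN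
    linarith [hsum_mono h2.le]
  have hT : largeDegCount c k n y ≤ ((Finset.range (n + 1)).filter fun i =>
      depth c i = k ∧ y < (children c n i : ℝ) + 1).card := by
    rw [← card_filter_level c n k fun i => y < (children c n i : ℝ) + 1]
    refine Finset.card_le_card (Finset.monotone_filter_right _ fun i _ hi => hi.trans_le ?_)
    exact_mod_cast deg_le_children_add_one c n i
  have hle : largeDegCount c k n y ≤ width c k K + S.card := by
    refine hT.trans ((Finset.card_le_card fun i hi => ?_).trans (Finset.card_union_le _ _))
    obtain ⟨h1, h2, h3⟩ := Finset.mem_filter.1 hi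
    rw [Finset.mem_union]
    rcases le_or_gt i K with h4 | h4
    · exact Or.inl (Finset.mem_filter.2 ⟨Finset.mem_range.2 (Nat.lt_succ_of_le h4), h2⟩)
    · exact Or.inr (Finset.mem_filter.2 ⟨h1, h4, h2, h3⟩)
  have := (le_div_iff₀ (by positivity)).2 hS
  have h4 : (largeDegCount c k n y : ℝ) ≤ width c k K + S.card := by exact_mod_cast hle
  linarith

/-! ### Cutting at a power of `n` and passing to the limit -/

theorem tendsto_floor_rpow {a : ℝ} (ha : 0 < a) :
    Tendsto (fun n : ℕ => ⌊(n : ℝ) ^ a⌋₊) atTop atTop :=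
  tendsto_nat_floor_atTop.comp ((tendsto_rpow_atTop ha).comp tendsto_natCast_atTop_atTop)

theorem tendsto_hsum_floor_rpow_div {a : ℝ} (ha : 0 < a) :
    Tendsto (fun n : ℕ => hsum ⌊(n : ℝ) ^ a⌋₊ / hsum n) atTop (𝓝 a) := by
  have h1 := tendsto_log_div_hsum.const_mul a
  have h2 := (tendsto_hsum.inv_tendsto_atTop).add h1
  rw [mul_one] at h1
  rw [mul_one, zero_add] at h2
  refine tendsto_of_tendsto_of_tendsto_of_le_of_le' h1 h2 ?_ ?_
  · filter_upwards [eventually_ge_atTop 1] with n hn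
    have hn' : (0 : ℝ) < n := by exact_mod_cast hn
    rw [← mul_div_assoc, ← Real.log_rpow hn', hsum_eq_harmonic ⌊(n : ℝ) ^ a⌋₊]
    exact div_le_div_of_nonneg_right (log_le_harmonic_floor _ (by positivity)) (hsum_nonneg n)
  · filter_upwards [eventually_ge_atTop 1] with n hn
    have hn' : (1 : ℝ) ≤ n := by exact_mod_cast hn
    simp only [Pi.inv_apply]
    rw [← mul_div_assoc, ← Real.log_rpow (by linarith), hsum_eq_harmonic ⌊(n : ℝ) ^ a⌋₊,
      ← one_div, ← add_div]
    exact div_le_div_of_nonneg_right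
      (harmonic_floor_le_one_add_log _ (Real.one_le_rpow hn' ha.le)) (hsum_nonneg n)

section Limit

variable {c : (m : ℕ) → Fin (m + 1)} {k : ℕ}
  (hw : Tendsto (fun n => (width c k n : ℝ) / hsum n ^ k) atTop (𝓝 (1 / (k.factorial : ℝ))))
  {N : ℕ → ℕ} (hN : Tendsto N atTop atTop)
  (hNn : Tendsto (fun n => hsum (N n) / hsum n) atTop (𝓝 1))

include hN hNn

theorem tendsto_hsum_floor_rpow_comp_div {a : ℝ} (ha : 0 < a) :
    Tendsto (fun n => hsum ⌊(N n : ℝ) ^ a⌋₊ / hsum n) atTop (𝓝 a) := by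
  have := ((tendsto_hsum_floor_rpow_div ha).comp hN).mul hNn
  rw [mul_one] at this
  refine this.congr' ?_
  filter_upwards [hN.eventually eventually_hsum_pos] with n hn
  rw [Function.comp_apply]
  field_simp

include hw in
theorem tendsto_width_floor_rpow {a : ℝ} (ha : 0 < a) :
    Tendsto (fun n => (width c k ⌊(N n : ℝ) ^ a⌋₊ : ℝ) / hsum n ^ k) atTop
      (𝓝 (1 / (k.factorial : ℝ) * a ^ k)) :=
  tendsto_div_hsum_pow_comp (u := fun n => (width c k n : ℝ))
    (hw.comp ((tendsto_floor_rpow ha).comp hN)) ((tendsto_floor_rpow ha).comp hN)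
    (tendsto_hsum_floor_rpow_comp_div hN hNn ha)

theorem tendsto_childrenNoise_div
    (hq : Tendsto (fun n => childrenNoise c k (N n) / hsum (N n) ^ (k + 2)) atTop (𝓝 0))
    (ε : ℝ) :
    Tendsto (fun n => childrenNoise c k (N n) / (ε * hsum n) ^ 2 / hsum n ^ k) atTop (𝓝 0) := by
  have := (tendsto_div_hsum_pow_comp (u := childrenNoise c k) hq hN hNn).div_const (ε ^ 2)
  rw [zero_mul, zero_div] at this
  refine this.congr fun n => ?_
  rw [mul_pow, div_div, div_div]
  ring

end Limit

/-- Cut at `K = ⌊N ^ a⌋`, with `N` the last sparse time up to `n`, since the noise is controlled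
only at sparse times. -/
theorem eventually_lt_largeDegCount {c : (m : ℕ) → Fin (m + 1)} {k : ℕ}
    (hw : Tendsto (fun n => (width c k n : ℝ) / hsum n ^ k) atTop (𝓝 (1 / (k.factorial : ℝ))))
    (hq : Tendsto (fun j => childrenNoise c k (sparse j) / hsum (sparse j) ^ (k + 2)) atTop (𝓝 0))
    {t a b : ℝ} (ht : 0 < t) (ha : 0 < a) (hat : a < 1 - t)
    (hb : b < 1 / (k.factorial : ℝ) * a ^ k) :
    ∀ᶠ n : ℕ in atTop, b < largeDegCount c k n (t * Real.log n) / hsum n ^ k := by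
  set N : ℕ → ℕ := fun n => sparse (sparseIndex n) with hNdef
  have hN : Tendsto N atTop atTop := tendsto_sparse_sparseIndex
  have hNn : Tendsto (fun n => hsum (N n) / hsum n) atTop (𝓝 1) := tendsto_hsum_sparse_div_hsum
  -- Half of the slack, in units of `hsum n`, between the mean `1 - a` at the cut and the threshold
  -- `t`; the deviation `δ` is `ε * hsum n`.
  set ε := (1 - t - a) / 2 with hε
  have hε0 : 0 < ε := by rw [hε]; linarith
  have h1 := (tendsto_width_floor_rpow hw hN hNn ha).sub
    (tendsto_childrenNoise_div hN hNn (hq.comp tendsto_sparseIndex) ε)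
  rw [sub_zero] at h1
  have h2 := (hNn.sub (tendsto_hsum_floor_rpow_comp_div hN hNn ha)).sub
    (tendsto_log_div_hsum.const_mul t)
  have h3 : ε < 1 - a - t * 1 := by rw [hε]; linarith
  filter_upwards [h1.eventually_const_lt hb, h2.eventually_const_lt h3, eventually_hsum_pos,
    eventually_ge_atTop 1] with n hn1 hn2 hn3 hn4
  refine hn1.trans_le ?_
  rw [← sub_div]
  refine div_le_div_of_nonneg_right ?_ (pow_nonneg (hsum_nonneg n) k)
  rw [← mul_div_assoc, ← sub_div, ← sub_div, lt_div_iff₀ hn3] at hn2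
  refine sub_le_iff_le_add.2 (width_le_largeDegCount_add c (sparse_sparseIndex_le hn4) ?_
    (mul_pos hε0 hn3) (by linarith))
  refine Nat.floor_le_of_le ?_
  calc (N n : ℝ) ^ a ≤ (N n : ℝ) ^ (1 : ℝ) :=
        Real.rpow_le_rpow_of_exponent_le (by exact_mod_cast one_le_sparse _) (by linarith)
    _ = N n := Real.rpow_one _

theorem eventually_largeDegCount_lt {c : (m : ℕ) → Fin (m + 1)} {k : ℕ}
    (hw : Tendsto (fun n => (width c k n : ℝ) / hsum n ^ k) atTop (𝓝 (1 / (k.factorial : ℝ))))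
    (hq : Tendsto (fun j => childrenNoise c k (sparse j) / hsum (sparse j) ^ (k + 2)) atTop (𝓝 0))
    {t a b : ℝ} (ha : 0 < a) (hat : 1 - t < a) (hb : 1 / (k.factorial : ℝ) * a ^ k < b) :
    ∀ᶠ n : ℕ in atTop, largeDegCount c k n (t * Real.log n) / hsum n ^ k < b := by
  set N : ℕ → ℕ := fun n => sparse (sparseIndex n + 1) with hNdef
  have hN : Tendsto N atTop atTop := tendsto_sparse_sparseIndex_succ
  have hNn : Tendsto (fun n => hsum (N n) / hsum n) atTop (𝓝 1) :=
    tendsto_hsum_sparse_succ_div_hsum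
  set ε := (a - (1 - t)) / 2 with hε
  have hε0 : 0 < ε := by rw [hε]; linarith
  have h1 := (tendsto_width_floor_rpow hw hN hNn ha).add
    (tendsto_childrenNoise_div hN hNn (hq.comp tendsto_sparseIndex_succ) ε)
  rw [add_zero] at h1
  -- The subtracted inverse of `hsum` accounts for the parent edge.
  have h2 := ((tendsto_log_div_hsum.const_mul t).sub
    (hNn.sub (tendsto_hsum_floor_rpow_comp_div hN hNn ha))).sub tendsto_hsum.inv_tendsto_atTop
  have h3 : ε < t * 1 - (1 - a) - 0 := by rw [hε]; linarith
  filter_upwards [h1.eventually_lt_const hb, h2.eventually_const_lt h3, eventually_hsum_pos]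
    with n hn1 hn2 hn3
  refine lt_of_le_of_lt ?_ hn1
  rw [← add_div]
  refine div_le_div_of_nonneg_right ?_ (pow_nonneg (hsum_nonneg n) k)
  rw [Pi.inv_apply, ← one_div, ← mul_div_assoc, ← sub_div, ← sub_div, ← sub_div,
    lt_div_iff₀ hn3] at hn2
  exact largeDegCount_le_width_add c (le_sparse_sparseIndex_succ n) (mul_pos hε0 hn3)
    (by linarith)

/-- Let the cut exponent `a` approach `1 - t` from below for the lower bound and from above for the
upper one. -/
theorem tendsto_largeDegCount {c : (m : ℕ) → Fin (m + 1)} {k : ℕ}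
    (hw : Tendsto (fun n => (width c k n : ℝ) / hsum n ^ k) atTop (𝓝 (1 / (k.factorial : ℝ))))
    (hq : Tendsto (fun j => childrenNoise c k (sparse j) / hsum (sparse j) ^ (k + 2)) atTop (𝓝 0))
    {t : ℝ} (ht0 : 0 < t) (ht1 : t < 1) :
    Tendsto (fun n : ℕ => (largeDegCount c k n (t * Real.log n) : ℝ) / hsum n ^ k) atTop
      (𝓝 (1 / (k.factorial : ℝ) * (1 - t) ^ k)) := by
  have hcont : Tendsto (fun a : ℝ => 1 / (k.factorial : ℝ) * a ^ k) (𝓝 (1 - t))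
      (𝓝 (1 / (k.factorial : ℝ) * (1 - t) ^ k)) :=
    Continuous.tendsto (by fun_prop) _
  refine tendsto_order.2 ⟨fun b hb => ?_, fun b hb => ?_⟩
  · have h1 := Tendsto.eventually_const_lt hb
      (hcont.mono_left (nhdsWithin_le_nhds (s := Set.Iio (1 - t))))
    have h2 : ∀ᶠ a in 𝓝[<] (1 - t), 0 < a :=
      nhdsWithin_le_nhds (Ioi_mem_nhds (sub_pos.2 ht1))
    obtain ⟨a, ⟨ha, ha1⟩, ha0⟩ := ((h1.and self_mem_nhdsWithin).and h2).exists
    exact eventually_lt_largeDegCount hw hq ht0 ha0 ha1 ha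
  · have h1 := Tendsto.eventually_lt_const hb
      (hcont.mono_left (nhdsWithin_le_nhds (s := Set.Ioi (1 - t))))
    obtain ⟨a, ha, ha1⟩ := (h1.and self_mem_nhdsWithin).exists
    exact eventually_largeDegCount_lt hw hq ((sub_pos.2 ht1).trans ha1) ha1 ha

theorem tendsto_Z {c : (m : ℕ) → Fin (m + 1)} {k : ℕ}
    (hw : Tendsto (fun n => (width c k n : ℝ) / hsum n ^ k) atTop (𝓝 (1 / (k.factorial : ℝ))))
    (hq : Tendsto (fun j => childrenNoise c k (sparse j) / hsum (sparse j) ^ (k + 2)) atTop (𝓝 0))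
    {t : ℝ} (ht0 : 0 < t) (ht1 : t < 1) :
    Tendsto (fun n => Z c n k t) atTop (𝓝 ((1 - t) ^ k)) := by
  have hfac : (k.factorial : ℝ) ≠ 0 := by exact_mod_cast k.factorial_ne_zero
  have h := (tendsto_largeDegCount hw hq ht0 ht1).div hw (one_div_ne_zero hfac)
  rw [mul_div_cancel_left₀ _ (one_div_ne_zero hfac)] at h
  refine h.congr' ?_
  filter_upwards [eventually_hsum_pos] with n hn
  rw [Pi.div_apply, div_div_div_cancel_right₀ (pow_pos hn k).ne', Z, card_level, largeDegCount]

end RecursiveTree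

theorem theorem2p1 {Ω : Type*} [MeasurableSpace Ω] (μ : Measure Ω) [IsProbabilityMeasure μ]
    (C : (m : ℕ) → Ω → Fin (m + 1)) (hC : RecursiveTree.IsUniformChoice μ C)
    (k : ℕ) (hk : 1 ≤ k) (t : ℝ) (ht0 : 0 < t) (ht1 : t < 1) :
    ∀ᵐ ω ∂μ, Tendsto (fun n : ℕ => RecursiveTree.Z (fun m => C m ω) n k t) atTop
      (𝓝 ((1 - t) ^ k)) := by
  filter_upwards [ae_all_iff.2 (RecursiveTree.ae_tendsto_widthNoise hC),
    RecursiveTree.ae_tendsto_childrenNoise hC k] with ω hw hq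
  exact RecursiveTree.tendsto_Z (RecursiveTree.tendsto_width hw k) hq ht0 ht1
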